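/- **Theorem 1 (fused penalty with known transferable structure).** Let $K\ge 1$. For $k=0,\dots,K$ let $y^{(k)}=X^{(k)}(\beta^*+\delta^{*(k)})+\varepsilon^{(k)}$ with $\delta^{*(0)}=0$, where $X^{(k)}$ is a random $n_k\times p$ matrix, $n_0=n_T$ (target), $n_k=n_S$ for $k\ge1$ (sources), and $N=Kn_S+n_T$. Assume: * all rows $X^{(k)}_{i\cdot}$ are independent, with mean zero and covariance $\Sigma^{(k)}$ whose eigenvalues lie in $[1/c,c]$, and are sub-Gaussian with constant $\tau$, that is, $\mathbb E\exp(t\langle v,X^{(k)}_{i\cdot}\rangle)\le\exp(\tau\|v\|_2^2t^2/2)$ for all $v\in\mathbb R^p$, $t\in\mathbb R$; * all noise entries $\varepsilon^{(k)}_i$ are independent centred Gaussian with variance $\sigma_k\le c$, and the noise is independent of the features. Put $S_0=\{j:\beta^*_j\ne0\}$ and $S_k=\{j:\delta^{*(k)}_j\neq0\}$ for $k\ge1$, and choose the weights $w^{(k)}_j=\mathbf 1\{j\in S_k^c\}$, $0\le k\le K$. Consider the weighted fused-penalty problem $$\min_{\beta,\delta^{(1)},\dots,\delta^{(K)}}\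 \frac1N\sum_{k=0}^K\|y^{(k)}-X^{(k)}(\beta+\delta^{(k)})\|_2^2+\lambda_0\sum_{j=1}^pw^{(0)}_j|\beta_j|+\lambda_1\sum_{k=1}^K\sum_{j=1}^pw^{(k)}_j|\delta^{(k)}_j|\qquad(\delta^{(0)}=0)$$ and the oracle constrained least-squares problem $$\min_{\beta,\delta^{(1)},\dots,\delta^{(K)}}\ \frac1N\sum_{k=0}^K\|y^{(k)}-X^{(k)}(\beta+\delta^{(k)})\|_2^2\quad\text{subject to}\quad\beta_{S_0^c}=0,\ \ \delta^{(k)}_{S_k^c}=0\ (1\le k\le K).$$ For all constants $c,\tau,c_S>0$ and $a\ge0$ there are constants $C,c_1>0$, depending only on $c,\tau,c_S,a$, such that the following holds. If $n_S\ge c_S\log p$, $K\le p^a$, $$\lambda_0\ge C\sqrt{\frac{\log p}{N}}\qquad\text{and}\qquad\lambda_1\ge C\,\frac{n_S}{N}\sqrt{\frac{\log p}{n_S}},$$ then with probability at least $1-\exp(-c_1\log p)$ the fused-penalty problem has a solution, and its set of solutions equals the set of solutions of the oracle problem. -/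

import Mathlib

open MeasureTheory ProbabilityTheory
open scoped NNReal Matrix

namespace AdaTrans

/-- Parameters of the multi-task model: the target parameter `β` and the `K` target-source
contrasts `δ⁽¹⁾, …, δ⁽ᴷ⁾`, all in `ℝᵖ`. -/
abbrev Param (K p : ℕ) : Type := (Fin p → ℝ) × (Fin K → Fin p → ℝ)

/-- Sample sizes: task `0` is the target (size `nT`), tasks `1, …, K` are the sources (size `nS`). -/
def sampleSize (K nT nS : ℕ) : Fin (K + 1) → ℕ := Fin.cons nT (fun _ => nS)

/-- The total sample size `N = K nS + nT`. -/
def totalSize (K nT nS : ℕ) : ℕ := K * nS + nT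

/-- One feature matrix for each task. -/
abbrev Design (K nT nS p : ℕ) : Type :=
  (k : Fin (K + 1)) → Matrix (Fin (sampleSize K nT nS k)) (Fin p) ℝ

/-- One vector of length the sample size for each task. -/
abbrev Sample (K nT nS : ℕ) : Type :=
  (k : Fin (K + 1)) → Fin (sampleSize K nT nS k) → ℝ

/-- The coefficient of task `k`: `β + δ⁽ᵏ⁾`, with the convention `δ⁽⁰⁾ = 0`. -/
def taskCoef {K p : ℕ} (θ : Param K p) (k : Fin (K + 1)) : Fin p → ℝ :=
  θ.1 + (Fin.cons 0 θ.2 : Fin (K + 1) → Fin p → ℝ) k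

/-- The responses of the linear models `y⁽ᵏ⁾ = X⁽ᵏ⁾ (β + δ⁽ᵏ⁾) + ε⁽ᵏ⁾`, `0 ≤ k ≤ K`. -/
def response {K nT nS p : ℕ} (X : Design K nT nS p) (ε : Sample K nT nS) (θ : Param K p) :
    Sample K nT nS :=
  fun k => X k *ᵥ taskCoef θ k + ε k

/-- The parameter blocks `(β, δ⁽¹⁾, …, δ⁽ᴷ⁾)`, indexed by `0, 1, …, K`. -/
def block {K p : ℕ} (θ : Param K p) : Fin (K + 1) → Fin p → ℝ := Fin.cons θ.1 θ.2

/-- The index sets `S₀ = {j | β_j ≠ 0}` and `S_k = {j | δ⁽ᵏ⁾_j ≠ 0}`. -/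
def supp {K p : ℕ} (θ : Param K p) (k : Fin (K + 1)) : Set (Fin p) := {j | block θ k j ≠ 0}

/-- The loss `(1/N) ∑_{k=0}^K ‖y⁽ᵏ⁾ - X⁽ᵏ⁾ (β + δ⁽ᵏ⁾)‖₂²`. -/
noncomputable def loss {K nT nS p : ℕ} (X : Design K nT nS p) (y : Sample K nT nS)
    (θ : Param K p) : ℝ :=
  1 / (totalSize K nT nS : ℝ) * ∑ k, ∑ i, (y k i - (X k *ᵥ taskCoef θ k) i) ^ 2

/-- The objective of the weighted fused-penalty problem. -/
noncomputable def objective {K nT nS p : ℕ} (X : Design K nT nS p) (y : Sample K nT nS)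
    (lam₀ lam₁ : ℝ) (w : Fin (K + 1) → Fin p → ℝ) (θ : Param K p) : ℝ :=
  loss X y θ + lam₀ * ∑ j, w 0 j * |θ.1 j| + lam₁ * ∑ k : Fin K, ∑ j, w k.succ j * |θ.2 k j|

/-- The solutions of the (unconstrained) weighted fused-penalty problem. -/
def fusedSolutions {K nT nS p : ℕ} (X : Design K nT nS p) (y : Sample K nT nS)
    (lam₀ lam₁ : ℝ) (w : Fin (K + 1) → Fin p → ℝ) : Set (Param K p) :=
  {θ | IsMinOn (objective X y lam₀ lam₁ w) Set.univ θ}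

/-- The constraint set `β_{S₀ᶜ} = 0`, `δ⁽ᵏ⁾_{S_kᶜ} = 0` for given index sets `S₀, …, S_K`. -/
def oracleFeasible {K p : ℕ} (S : Fin (K + 1) → Set (Fin p)) : Set (Param K p) :=
  {θ | ∀ k, ∀ j ∈ (S k)ᶜ, block θ k j = 0}

/-- The oracle estimators: the solutions of least squares constrained to `oracleFeasible S`. -/
def oracleSolutions {K nT nS p : ℕ} (X : Design K nT nS p) (y : Sample K nT nS)
    (S : Fin (K + 1) → Set (Fin p)) : Set (Param K p) :=
  {θ | θ ∈ oracleFeasible S ∧ IsMinOn (loss X y) (oracleFeasible S) θ}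

/-- The weights `w_j⁽ᵏ⁾ = 1{j ∈ S_kᶜ}`, `0 ≤ k ≤ K`. -/
noncomputable def oracleWeight {K p : ℕ} (S : Fin (K + 1) → Set (Fin p)) :
    Fin (K + 1) → Fin p → ℝ :=
  fun k => (S k)ᶜ.indicator 1

/-- A random vector `x` in `ℝᵖ` is centred sub-Gaussian with constant `τ`:
`E exp(t ⟨v, x⟩) ≤ exp(τ ‖v‖₂² t² / 2)` for all `v ∈ ℝᵖ` and `t ∈ ℝ`. -/
def IsSubGaussianVector {Ω : Type*} [MeasurableSpace Ω] {p : ℕ} (x : Ω → Fin p → ℝ) (τ : ℝ≥0)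
    (P : Measure Ω) : Prop :=
  ∀ v : EuclideanSpace ℝ (Fin p),
    HasSubgaussianMGF (fun ω => ∑ j, v j * x ω j) (τ * ‖v‖₊ ^ 2) P

/-- Design assumption. All the rows `X⁽ᵏ⁾_{i·}` are independent sub-Gaussian vectors with mean zero
and covariance `Σ⁽ᵏ⁾`, whose eigenvalues lie in `[1/c, c]`. -/
structure DesignAssumption {Ω : Type*} [MeasurableSpace Ω] {K nT nS p : ℕ} (P : Measure Ω)
    (X : Ω → Design K nT nS p) (Sig : Fin (K + 1) → Matrix (Fin p) (Fin p) ℝ)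
    (τ : ℝ≥0) (c : ℝ) : Prop where
  measurable : ∀ k i, Measurable (fun ω => X ω k i)
  indep : iIndepFun
    (fun (r : (k : Fin (K + 1)) × Fin (sampleSize K nT nS k)) ω => X ω r.1 r.2) P
  subGaussian : ∀ k i, IsSubGaussianVector (fun ω => X ω k i) τ P
  mean_zero : ∀ k i j, ∫ ω, X ω k i j ∂P = 0
  covariance_eq : ∀ k i j l, cov[fun ω => X ω k i j, fun ω => X ω k i l; P] = Sig k j l
  eigenvalues_bound : ∀ k, ∀ μ ∈ spectrum ℝ (Sig k), 1 / c ≤ μ ∧ μ ≤ c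

/-- Noise assumption. All the `ε⁽ᵏ⁾_i` are independent centred Gaussian variables with variance
`σ_k ≤ c`, and the noise is independent of the features. -/
structure NoiseAssumption {Ω : Type*} [MeasurableSpace Ω] {K nT nS p : ℕ} (P : Measure Ω)
    (X : Ω → Design K nT nS p) (ε : Ω → Sample K nT nS) (σ : Fin (K + 1) → ℝ≥0)
    (c : ℝ) : Prop where
  measurable : ∀ k i, Measurable (fun ω => ε ω k i)
  indep : iIndepFun
    (fun (r : (k : Fin (K + 1)) × Fin (sampleSize K nT nS k)) ω => ε ω r.1 r.2) P
  gaussian : ∀ k i, P.map (fun ω => ε ω k i) = gaussianReal 0 (σ k)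
  variance_le : ∀ k, (σ k : ℝ) ≤ c
  indep_design : IndepFun
    (fun ω (r : (k : Fin (K + 1)) × Fin (sampleSize K nT nS k)) => X ω r.1 r.2)
    (fun ω (r : (k : Fin (K + 1)) × Fin (sampleSize K nT nS k)) => ε ω r.1 r.2) P

end AdaTrans

/-!
Project the noise off the span of the stacked design columns which the oracle leaves free. Whatever
the true parameter, this is the residual of the oracle estimator. When its inner products with all
the other columns stay strictly below the penalty levels (up to the factor `2 / N`), it is a strict
primal-dual certificate: the fused-penalty objective exceeds the oracle minimum by at least a
weighted `ℓ¹` norm of the penalized coordinates with positive weights, so both problems have the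
same minimizers.

Since noise and design are independent, each such inner product is, conditionally on the design,
sub-Gaussian with variance at most a constant times the squared norm of the column, because the
projection does not increase norms. The squared norm of a column is a sum of squares of independent
sub-Gaussian variables, hence of the order of the number of observations on which the column acts:
`N` for `β` and `nS` for a contrast, which explains the two rates of the penalty levels. The theorem
follows by a union bound over the `(K + 1) * p` columns.
-/

namespace AdaTrans

lemma isMinOn_univ_iff_of_eqOn {α β : Type*} [Preorder β] {f g : α → β} {F : Set α} {x₀ : α}
    (hfg : Set.EqOn g f F) (hx₀ : x₀ ∈ F) (hle : ∀ x, f x₀ ≤ g x)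
    (hmem : ∀ x, g x ≤ f x₀ → x ∈ F) (x : α) :
    IsMinOn g Set.univ x ↔ x ∈ F ∧ IsMinOn f F x := by
  constructor
  · intro hx
    have hxF : x ∈ F := hmem x ((hx (Set.mem_univ x₀)).trans_eq (hfg hx₀))
    exact ⟨hxF, fun z hz => (hfg hxF).symm.trans_le ((hx (Set.mem_univ z)).trans_eq (hfg hz))⟩
  · rintro ⟨hxF, hx⟩ z -
    exact (hfg hxF).trans_le ((hx hx₀).trans (hle z))

section Lasso

variable {ι E : Type*} [NormedAddCommGroup E] [InnerProductSpace ℝ E]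
  {a : ℝ} {u : ι → E} {y r : E} {S : Set ι} {μ : ι → ℝ}

/-- The coefficient vectors which vanish off `S`. -/
def supportedOn (S : Set ι) : Set (ι → ℝ) := {b | ∀ i ∉ S, b i = 0}

/-- A strict primal-dual certificate for the lasso: `r` is the residual of the projection of `y`
onto the span of the unpenalized columns `S`, and the subgradient which it defines is strictly
feasible off `S`. -/
structure IsDualCertificate (a : ℝ) (u : ι → E) (y : E) (S : Set ι) (μ : ι → ℝ) (r : E) : Prop where
  mem_orthogonal : r ∈ (Submodule.span ℝ (u '' S))ᗮ
  sub_mem_span : y - r ∈ Submodule.span ℝ (u '' S)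
  penalty_eq_zero : ∀ i ∈ S, μ i = 0
  abs_inner_lt : ∀ i ∉ S, 2 * a * |inner ℝ (u i) r| < μ i

namespace IsDualCertificate

lemma inner_eq_zero (h : IsDualCertificate a u y S μ r) {i : ι} (hi : i ∈ S) :
    inner ℝ (u i) r = 0 :=
  h.mem_orthogonal _ (Submodule.subset_span (Set.mem_image_of_mem u hi))

lemma gap_nonneg (h : IsDualCertificate a u y S μ r) (b : ι → ℝ) (i : ι) :
    0 ≤ (μ i - 2 * a * |inner ℝ (u i) r|) * |b i| := by
  by_cases hi : i ∈ S
  · simp [h.inner_eq_zero hi, h.penalty_eq_zero i hi]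
  · exact mul_nonneg (sub_pos.2 (h.abs_inner_lt i hi)).le (abs_nonneg _)

end IsDualCertificate

variable [Fintype ι]

/-- The least squares loss with scale factor `a`, columns `u` and response `y`. -/
def leastSquares (a : ℝ) (u : ι → E) (y : E) (b : ι → ℝ) : ℝ :=
  a * ‖y - ∑ i, b i • u i‖ ^ 2

/-- The lasso objective, with one penalty level `μ i` for each column; `μ i = 0` leaves column `i`
unpenalized. -/
def lasso (a : ℝ) (u : ι → E) (y : E) (μ : ι → ℝ) (b : ι → ℝ) : ℝ :=
  leastSquares a u y b + ∑ i, μ i * |b i|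

lemma inner_sum_smul_le (b : ι → ℝ) :
    inner ℝ (∑ i, b i • u i) r ≤ ∑ i, |inner ℝ (u i) r| * |b i| := by
  simp only [sum_inner, real_inner_smul_left]
  exact Finset.sum_le_sum fun i _ => (le_abs_self _).trans_eq (by rw [abs_mul, mul_comm])

lemma add_sum_le_lasso (ha : 0 ≤ a) (hr : inner ℝ (y - r) r = 0) (b : ι → ℝ) :
    a * ‖r‖ ^ 2 + ∑ i, (μ i - 2 * a * |inner ℝ (u i) r|) * |b i| ≤ lasso a u y μ b := by
  set z := ∑ i, b i • u i with hz
  have hsq : ‖r‖ ^ 2 - 2 * inner ℝ z r ≤ ‖y - z‖ ^ 2 := by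
    have hsplit : y - z = r + (y - r - z) := by abel
    have hinner : inner ℝ r (y - r - z) = - inner ℝ z r := by
      rw [real_inner_comm, inner_sub_left, hr, zero_sub]
    rw [hsplit, norm_add_sq_real, hinner]
    nlinarith [sq_nonneg ‖y - r - z‖]
  have hgap : ∑ i, (μ i - 2 * a * |inner ℝ (u i) r|) * |b i|
      = ∑ i, μ i * |b i| - 2 * a * ∑ i, |inner ℝ (u i) r| * |b i| := by
    rw [Finset.mul_sum, ← Finset.sum_sub_distrib]
    exact Finset.sum_congr rfl fun i _ => by ring
  rw [lasso, leastSquares, ← hz, hgap]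
  linarith [mul_le_mul_of_nonneg_left hsq ha,
    mul_le_mul_of_nonneg_left (inner_sum_smul_le (u := u) (r := r) b) ha]

lemma exists_mem_supportedOn_sum_smul_eq {w : E} (hw : w ∈ Submodule.span ℝ (u '' S)) :
    ∃ b ∈ supportedOn S, ∑ i, b i • u i = w := by
  obtain ⟨l, hl, rfl⟩ := (Finsupp.mem_span_image_iff_linearCombination ℝ).1 hw
  refine ⟨l, fun i hi => (Finsupp.mem_supported' ℝ l).1 hl i hi, ?_⟩
  rw [Finsupp.linearCombination_apply, Finsupp.sum_fintype _ _ (by simp)]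

lemma sum_smul_mem_span_image {b : ι → ℝ} (hb : b ∈ supportedOn S) :
    ∑ i, b i • u i ∈ Submodule.span ℝ (u '' S) := by
  refine Submodule.sum_mem _ fun i _ => ?_
  by_cases hi : i ∈ S
  · exact Submodule.smul_mem _ _ (Submodule.subset_span (Set.mem_image_of_mem u hi))
  · simp [hb i hi]

namespace IsDualCertificate

lemma le_lasso (h : IsDualCertificate a u y S μ r) (ha : 0 ≤ a) (b : ι → ℝ) :
    a * ‖r‖ ^ 2 ≤ lasso a u y μ b :=
  (le_add_of_nonneg_right (Finset.sum_nonneg fun i _ => h.gap_nonneg b i)).trans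
    (add_sum_le_lasso ha (h.mem_orthogonal _ h.sub_mem_span) b)

lemma mem_supportedOn_of_lasso_le (h : IsDualCertificate a u y S μ r) (ha : 0 ≤ a) {b : ι → ℝ}
    (hb : lasso a u y μ b ≤ a * ‖r‖ ^ 2) : b ∈ supportedOn S := by
  intro i hi
  have hsum : ∑ i, (μ i - 2 * a * |inner ℝ (u i) r|) * |b i| ≤ 0 := by
    linarith [add_sum_le_lasso (u := u) (μ := μ) ha (h.mem_orthogonal _ h.sub_mem_span) b]
  have hterm : (μ i - 2 * a * |inner ℝ (u i) r|) * |b i| ≤ 0 :=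
    (Finset.single_le_sum (fun i _ => h.gap_nonneg b i) (Finset.mem_univ i)).trans hsum
  by_contra hne
  exact hterm.not_gt (mul_pos (sub_pos.2 (h.abs_inner_lt i hi)) (abs_pos.2 hne))

lemma eqOn_lasso_leastSquares (h : IsDualCertificate a u y S μ r) :
    Set.EqOn (lasso a u y μ) (leastSquares a u y) (supportedOn S) := by
  intro b hb
  refine add_eq_left.2 (Finset.sum_eq_zero fun i _ => ?_)
  by_cases hi : i ∈ S
  · rw [h.penalty_eq_zero i hi, zero_mul]
  · rw [hb i hi, abs_zero, mul_zero]

lemma exists_leastSquares_eq (h : IsDualCertificate a u y S μ r) :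
    ∃ b ∈ supportedOn S, leastSquares a u y b = a * ‖r‖ ^ 2 := by
  obtain ⟨b, hb, hfit⟩ := exists_mem_supportedOn_sum_smul_eq h.sub_mem_span
  exact ⟨b, hb, by rw [leastSquares, hfit, sub_sub_cancel]⟩

theorem exists_isMinOn_lasso (h : IsDualCertificate a u y S μ r) (ha : 0 ≤ a) :
    ∃ b, IsMinOn (lasso a u y μ) Set.univ b := by
  obtain ⟨b, hb, hval⟩ := h.exists_leastSquares_eq
  refine ⟨b, fun b' _ => ?_⟩
  exact ((h.eqOn_lasso_leastSquares hb).trans hval).trans_le (h.le_lasso ha b')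

theorem isMinOn_lasso_iff (h : IsDualCertificate a u y S μ r) (ha : 0 ≤ a) (b : ι → ℝ) :
    IsMinOn (lasso a u y μ) Set.univ b ↔
      b ∈ supportedOn S ∧ IsMinOn (leastSquares a u y) (supportedOn S) b := by
  obtain ⟨b₀, hb₀, hval⟩ := h.exists_leastSquares_eq
  refine isMinOn_univ_iff_of_eqOn h.eqOn_lasso_leastSquares hb₀ (fun b' => ?_) (fun b' hb' => ?_) b
  · exact hval.trans_le (h.le_lasso ha b')
  · exact h.mem_supportedOn_of_lasso_le ha (hb'.trans_eq hval)

end IsDualCertificate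

end Lasso

section SubGaussian

variable {Ω : Type*} [MeasurableSpace Ω] {P : Measure Ω}

lemma hasSubgaussianMGF_mono {X : Ω → ℝ} {c d : ℝ≥0} (h : HasSubgaussianMGF X c P) (hcd : c ≤ d) :
    HasSubgaussianMGF X d P :=
  ⟨h.integrable_exp_mul, fun t => (h.mgf_le t).trans (by gcongr)⟩

lemma measureReal_abs_ge_le [IsFiniteMeasure P] {X : Ω → ℝ} {c : ℝ≥0}
    (h : HasSubgaussianMGF X c P) {t : ℝ} (ht : 0 ≤ t) :
    P.real {ω | t ≤ |X ω|} ≤ 2 * Real.exp (-t ^ 2 / (2 * c)) := by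
  have hsub : {ω | t ≤ |X ω|} ⊆ {ω | t ≤ X ω} ∪ {ω | t ≤ (-X) ω} := fun ω hω => by
    simpa only [Set.mem_union, Set.mem_ofPred_eq, Pi.neg_apply, le_abs] using hω
  refine (measureReal_mono hsub).trans ((measureReal_union_le _ _).trans ?_)
  rw [two_mul]
  exact add_le_add (h.measure_ge_le ht) (h.neg.measure_ge_le ht)

lemma hasSubgaussianMGF_of_map_eq_gaussianReal {X : Ω → ℝ} (hX : AEMeasurable X P) {v : ℝ≥0}
    (h : P.map X = gaussianReal 0 v) : HasSubgaussianMGF X v P := by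
  rw [← HasSubgaussianMGF.id_map_iff hX, h]
  exact ⟨integrable_exp_mul_gaussianReal, fun t => by simp [mgf_id_gaussianReal]⟩

lemma lintegral_exp_mul_gaussianReal (t : ℝ) :
    ∫⁻ g, ENNReal.ofReal (Real.exp (t * g)) ∂gaussianReal 0 1
      = ENNReal.ofReal (Real.exp (t ^ 2 / 2)) := by
  rw [← ofReal_integral_eq_lintegral_ofReal (integrable_exp_mul_gaussianReal t)
    (ae_of_all _ fun _ => (Real.exp_pos _).le)]
  congr 1
  simpa [mgf] using congrFun (mgf_fun_id_gaussianReal (μ := 0) (v := 1)) t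

lemma integral_exp_sq_div_four_gaussianReal :
    ∫ g, Real.exp (g ^ 2 / 4) ∂gaussianReal 0 1 = √2 := by
  have hpdf (g : ℝ) : gaussianPDFReal 0 1 g • Real.exp (g ^ 2 / 4)
      = (√(2 * Real.pi))⁻¹ * Real.exp (-(1 / 4) * g ^ 2) := by
    rw [gaussianPDFReal_def, smul_eq_mul, mul_assoc, ← Real.exp_add]
    simp only [NNReal.coe_one, mul_one, sub_zero]
    ring_nf
  simp_rw [integral_gaussianReal_eq_integral_smul one_ne_zero, hpdf]
  rw [integral_const_mul, integral_gaussian, ← Real.sqrt_inv, ← Real.sqrt_mul (by positivity)]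
  congr 1
  field_simp
  norm_num

lemma lintegral_exp_mul_sq_gaussianReal_le {s : ℝ} (hs : 4 * s ≤ 1) :
    ∫⁻ g, ENNReal.ofReal (Real.exp (s * g ^ 2)) ∂gaussianReal 0 1 ≤ ENNReal.ofReal √2 := by
  have hint : Integrable (fun g : ℝ => Real.exp (g ^ 2 / 4)) (gaussianReal 0 1) :=
    .of_integral_ne_zero (by rw [integral_exp_sq_div_four_gaussianReal]; positivity)
  rw [← integral_exp_sq_div_four_gaussianReal,
    ofReal_integral_eq_lintegral_ofReal hint (ae_of_all _ fun _ => (Real.exp_pos _).le)]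
  gcongr with g
  nlinarith [mul_le_mul_of_nonneg_right hs (sq_nonneg g)]

-- Decoupling: `exp (s x ^ 2)` is the Gaussian average of `exp (√(2 s) g x)`, and by Tonelli the
-- sub-Gaussian bound may be applied for each fixed `g`.
lemma lintegral_exp_mul_sq_le [SFinite P] {X : Ω → ℝ} {τ : ℝ≥0} (hX : HasSubgaussianMGF X τ P)
    {s : ℝ} (hs : 0 ≤ s) :
    ∫⁻ ω, ENNReal.ofReal (Real.exp (s * X ω ^ 2)) ∂P
      ≤ ∫⁻ g, ENNReal.ofReal (Real.exp (τ * s * g ^ 2)) ∂gaussianReal 0 1 := by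
  have hsq : √(2 * s) ^ 2 = 2 * s := Real.sq_sqrt (by positivity)
  have hXm : AEMeasurable X P := hX.aemeasurable
  calc ∫⁻ ω, ENNReal.ofReal (Real.exp (s * X ω ^ 2)) ∂P
      = ∫⁻ ω, ∫⁻ g, ENNReal.ofReal (Real.exp (√(2 * s) * X ω * g)) ∂gaussianReal 0 1 ∂P := by
        simp_rw [lintegral_exp_mul_gaussianReal, mul_pow, hsq]
        ring_nf
    _ = ∫⁻ g, ∫⁻ ω, ENNReal.ofReal (Real.exp (√(2 * s) * g * X ω)) ∂P ∂gaussianReal 0 1 := by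
        rw [lintegral_lintegral_swap (by unfold Function.uncurry; fun_prop)]
        simp_rw [mul_right_comm]
    _ ≤ ∫⁻ g, ENNReal.ofReal (Real.exp (τ * s * g ^ 2)) ∂gaussianReal 0 1 := by
        refine lintegral_mono fun g => ?_
        rw [← ofReal_integral_eq_lintegral_ofReal (hX.integrable_exp_mul _)
          (ae_of_all _ fun _ => (Real.exp_pos _).le)]
        refine ENNReal.ofReal_le_ofReal ((hX.mgf_le _).trans_eq ?_)
        rw [mul_pow, hsq]
        ring_nf

lemma lintegral_exp_mul_sq_le_sqrt_two [SFinite P] {X : Ω → ℝ} {τ : ℝ≥0}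
    (hX : HasSubgaussianMGF X τ P) {s : ℝ} (hs : 0 ≤ s) (hτs : 4 * (τ * s) ≤ 1) :
    ∫⁻ ω, ENNReal.ofReal (Real.exp (s * X ω ^ 2)) ∂P ≤ ENNReal.ofReal √2 :=
  (lintegral_exp_mul_sq_le hX hs).trans (lintegral_exp_mul_sq_gaussianReal_le hτs)

lemma integrable_exp_mul_sq [SFinite P] {X : Ω → ℝ} {τ : ℝ≥0} (hX : HasSubgaussianMGF X τ P)
    {s : ℝ} (hs : 0 ≤ s) (hτs : 4 * (τ * s) ≤ 1) :
    Integrable (fun ω => Real.exp (s * X ω ^ 2)) P := by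
  have hXm : AEMeasurable X P := hX.aemeasurable
  refine ⟨AEMeasurable.aestronglyMeasurable (by fun_prop), ?_⟩
  rw [hasFiniteIntegral_iff_ofReal (ae_of_all _ fun _ => (Real.exp_pos _).le)]
  exact (lintegral_exp_mul_sq_le_sqrt_two hX hs hτs).trans_lt ENNReal.ofReal_lt_top

lemma mgf_sq_le [SFinite P] {X : Ω → ℝ} {τ : ℝ≥0} (hX : HasSubgaussianMGF X τ P)
    {s : ℝ} (hs : 0 ≤ s) (hτs : 4 * (τ * s) ≤ 1) :
    mgf (fun ω => X ω ^ 2) P s ≤ √2 := by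
  rw [← ENNReal.ofReal_le_ofReal_iff (Real.sqrt_nonneg 2), mgf,
    ofReal_integral_eq_lintegral_ofReal (integrable_exp_mul_sq hX hs hτs)
      (ae_of_all _ fun _ => (Real.exp_pos _).le)]
  exact lintegral_exp_mul_sq_le_sqrt_two hX hs hτs

/-- The level which the mean square of independent sub-Gaussian variables with constant `τ` exceeds
with exponentially small probability, at rate `A` per variable. The constant comes from the
exponential moment of `X ^ 2` at `1 / (4 * (τ + 1))`, where `τ + 1` rather than `τ` covers
`τ = 0`. -/
def meanSquareLevel (τ : ℝ≥0) (A : ℝ) : ℝ := 4 * (τ + 1) * (1 + A)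

lemma measureReal_sum_sq_ge_le [IsFiniteMeasure P] {ι : Type*} {X : ι → Ω → ℝ} {τ : ℝ≥0}
    (hX : ∀ i, Measurable (X i)) (hind : iIndepFun X P) (hsub : ∀ i, HasSubgaussianMGF (X i) τ P)
    (T : Finset ι) (A : ℝ) :
    P.real {ω | meanSquareLevel τ A * T.card ≤ ∑ i ∈ T, X i ω ^ 2}
      ≤ Real.exp (-A * T.card) := by
  set s : ℝ := 1 / (4 * (τ + 1)) with hs
  have hs0 : 0 ≤ s := by positivity
  have hτs : 4 * (τ * s) ≤ 1 := by
    rw [hs]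
    field_simp
    linarith
  have hlevel : s * meanSquareLevel τ A = 1 + A := by
    rw [hs, meanSquareLevel]
    field_simp
  have hind_sq : iIndepFun (fun i ω => X i ω ^ 2) P :=
    hind.comp (fun _ x => x ^ 2) fun _ => by fun_prop
  have hmeas_sq (i : ι) : Measurable fun ω => X i ω ^ 2 := (hX i).pow_const 2
  have hchernoff := measure_ge_le_exp_mul_mgf (meanSquareLevel τ A * T.card) hs0
    (hind_sq.integrable_exp_mul_sum hmeas_sq (s := T) fun i _ =>
      integrable_exp_mul_sq (hsub i) hs0 hτs)
  have hsqrt : √2 ≤ Real.exp 1 := by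
    rw [Real.sqrt_le_iff]
    exact ⟨by positivity, by nlinarith [Real.add_one_le_exp (1 : ℝ)]⟩
  have hprod : ∏ i ∈ T, mgf (fun ω => X i ω ^ 2) P s ≤ Real.exp 1 ^ T.card :=
    (Finset.prod_le_prod (fun _ _ => mgf_nonneg) fun i _ =>
      (mgf_sq_le (hsub i) hs0 hτs).trans hsqrt).trans_eq (by simp only [Finset.prod_const])
  rw [hind_sq.mgf_sum hmeas_sq] at hchernoff
  simp only [Finset.sum_apply] at hchernoff
  calc P.real {ω | meanSquareLevel τ A * T.card ≤ ∑ i ∈ T, X i ω ^ 2}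
      ≤ Real.exp (-s * (meanSquareLevel τ A * T.card)) * Real.exp 1 ^ T.card :=
        hchernoff.trans (by gcongr)
    _ = Real.exp (-A * T.card) := by
        rw [← Real.exp_nat_mul, ← Real.exp_add]
        congr 1
        linear_combination -(T.card : ℝ) * hlevel

end SubGaussian

section Projection

variable {Z ι E : Type*} [MeasurableSpace Z] [NormedAddCommGroup E] [InnerProductSpace ℝ E]

lemma inner_starProjection_eq_norm_sq_sub_norm_sq_div_four (V : Submodule ℝ E)
    [V.HasOrthogonalProjection] (u w : E) :
    inner ℝ u (V.starProjection w)
      = (‖V.starProjection (u + w)‖ ^ 2 - ‖V.starProjection (u - w)‖ ^ 2) / 4 := by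
  have hproj : inner ℝ u (V.starProjection w)
      = inner ℝ (V.starProjection u) (V.starProjection w) := by
    rw [V.inner_starProjection_left_eq_right, V.starProjection_eq_self_iff.2
      (V.starProjection_apply_mem w)]
  rw [hproj, map_add, map_sub, norm_add_sq_real, norm_sub_sq_real]
  ring

variable [FiniteDimensional ℝ E]

-- Rational combinations are dense in the span, which makes the residual norm a countable infimum.
lemma norm_starProjection_orthogonal_span_lt_iff [Fintype ι] (a : ι → E) (w : E) (r : ℝ) :
    ‖(Submodule.span ℝ (Set.range a))ᗮ.starProjection w‖ < r ↔
      ∃ q : ι → ℚ, ‖w - ∑ i, (q i : ℝ) • a i‖ < r := by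
  rw [Submodule.starProjection_orthogonal_val]
  constructor
  · intro h
    obtain ⟨x, hx⟩ := (Submodule.mem_span_range_iff_exists_fun ℝ).1
      ((Submodule.span ℝ (Set.range a)).starProjection_apply_mem w)
    have hopen : IsOpen {x : ι → ℝ | ‖w - ∑ i, x i • a i‖ < r} :=
      isOpen_lt (by fun_prop) continuous_const
    have hdense : DenseRange (Pi.map fun (_ : ι) (q : ℚ) => (q : ℝ)) :=
      DenseRange.piMap fun _ => Rat.denseRange_cast
    exact hdense.exists_mem_open hopen ⟨x, by rwa [Set.mem_ofPred_eq, hx]⟩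
  · rintro ⟨q, hq⟩
    refine lt_of_le_of_lt ?_ hq
    rw [Submodule.starProjection_minimal]
    exact ciInf_le ⟨0, by rintro _ ⟨_, rfl⟩; positivity⟩
      (⟨_, (Submodule.mem_span_range_iff_exists_fun ℝ).2 ⟨fun i => q i, rfl⟩⟩ :
        Submodule.span ℝ (Set.range a))

variable [MeasurableSpace E] [BorelSpace E] {a : ι → Z → E} {u w : Z → E}

lemma measurable_norm_starProjection_orthogonal_span [Finite ι] (ha : ∀ i, Measurable (a i))
    (hw : Measurable w) :
    Measurable fun z => ‖(Submodule.span ℝ (Set.range (a · z)))ᗮ.starProjection (w z)‖ := by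
  have := Fintype.ofFinite ι
  refine measurable_of_Iio fun r => ?_
  simp only [Set.preimage_ofPred_eq, Set.Iio, norm_starProjection_orthogonal_span_lt_iff,
    Set.ofPred_exists]
  exact MeasurableSet.iUnion fun q => measurableSet_lt (by fun_prop) measurable_const

lemma measurable_inner_starProjection_orthogonal_span [Finite ι] (ha : ∀ i, Measurable (a i))
    (hu : Measurable u) (hw : Measurable w) :
    Measurable fun z =>
      inner ℝ (u z) ((Submodule.span ℝ (Set.range (a · z)))ᗮ.starProjection (w z)) := by
  simp_rw [inner_starProjection_eq_norm_sq_sub_norm_sq_div_four]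
  exact (((measurable_norm_starProjection_orthogonal_span ha (hu.add hw)).pow_const 2).sub
    ((measurable_norm_starProjection_orthogonal_span ha (hu.sub hw)).pow_const 2)).div_const 4

end Projection

section ConditionalTail

variable {Ω α β ι E : Type*} [MeasurableSpace Ω] [MeasurableSpace α] [MeasurableSpace β]
  [NormedAddCommGroup E] [InnerProductSpace ℝ E] {P : Measure Ω} {c : ℝ≥0} {e : Ω → E}

/-- All the one-dimensional marginals of the random vector `e` are sub-Gaussian, with constant `c`
in the directions of norm one: a coordinate-free form of `IsSubGaussianVector`. -/
def HasSubgaussianMarginals (e : Ω → E) (c : ℝ≥0) (P : Measure Ω) : Prop :=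
  ∀ v, HasSubgaussianMGF (fun ω => inner ℝ v (e ω)) (c * ‖v‖₊ ^ 2) P

lemma hasSubgaussianMarginals_of_iIndepFun [Fintype ι] {X : ι → Ω → ℝ} (hind : iIndepFun X P)
    (hX : ∀ i, HasSubgaussianMGF (X i) c P) :
    HasSubgaussianMarginals (fun ω => WithLp.toLp 2 (X · ω) : Ω → EuclideanSpace ℝ ι) c P := by
  intro v
  have hconst : ∑ i, NNReal.mk (v i ^ 2) (sq_nonneg (v i)) * c = c * ‖v‖₊ ^ 2 := by
    rw [← Finset.sum_mul, mul_comm, ← NNReal.coe_inj]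
    push_cast
    rw [EuclideanSpace.real_norm_sq_eq]
  have hsum := HasSubgaussianMGF.sum_of_iIndepFun (s := Finset.univ)
    (hind.comp (fun i x => v i * x) fun i => by fun_prop) fun i _ => (hX i).const_mul (v i)
  simpa [PiLp.inner_apply, mul_comm] using hasSubgaussianMGF_mono hsum hconst.le

namespace HasSubgaussianMarginals

lemma measureReal_abs_inner_ge_le [IsFiniteMeasure P] (he : HasSubgaussianMarginals e c P) {v : E}
    {R : ℝ} (hv : ‖v‖ ^ 2 ≤ R) {t : ℝ} (ht : 0 ≤ t) :
    P.real {ω | t ≤ |inner ℝ v (e ω)|} ≤ 2 * Real.exp (-t ^ 2 / (2 * (c * R))) := by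
  lift R to ℝ≥0 using (sq_nonneg _).trans hv
  have hle : c * ‖v‖₊ ^ 2 ≤ c * R := by gcongr; exact hv
  exact_mod_cast measureReal_abs_ge_le (hasSubgaussianMGF_mono (he v) hle) ht

lemma measureReal_abs_inner_starProjection_ge_le [IsFiniteMeasure P]
    (he : HasSubgaussianMarginals e c P) (V : Submodule ℝ E) [V.HasOrthogonalProjection] {v : E}
    {R : ℝ} (hv : ‖v‖ ^ 2 ≤ R) {t : ℝ} (ht : 0 ≤ t) :
    P.real {ω | t ≤ |inner ℝ v (V.starProjection (e ω))|}
      ≤ 2 * Real.exp (-t ^ 2 / (2 * (c * R))) := by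
  have hproj : ‖V.starProjection v‖ ^ 2 ≤ R :=
    (pow_le_pow_left₀ (norm_nonneg _) (V.norm_starProjection_apply_le v) 2).trans hv
  simpa only [V.inner_starProjection_left_eq_right] using he.measureReal_abs_inner_ge_le hproj ht

end HasSubgaussianMarginals

lemma measureReal_le_of_indepFun [IsProbabilityMeasure P] {U : Ω → α} {W : Ω → β}
    (hU : Measurable U) (hW : Measurable W) (hUW : IndepFun U W P) {H : Set (α × β)}
    (hH : MeasurableSet H) {A : Set α} (hA : MeasurableSet A) {q : ℝ} (hq : 0 ≤ q)
    (h : ∀ x ∉ A, P.real {ω | (x, W ω) ∈ H} ≤ q) :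
    P.real {ω | (U ω, W ω) ∈ H} ≤ P.real {ω | U ω ∈ A} + q := by
  have : IsProbabilityMeasure (P.map U) := Measure.isProbabilityMeasure_map hU.aemeasurable
  have : IsProbabilityMeasure (P.map W) := Measure.isProbabilityMeasure_map hW.aemeasurable
  lift q to ℝ≥0 using hq
  have hjoint : P {ω | (U ω, W ω) ∈ H} = ∫⁻ x, (P.map W) (Prod.mk x ⁻¹' H) ∂P.map U := by
    rw [← Measure.prod_apply hH, ← hUW.map_prod_eq_prod_map_map hU.aemeasurable hW.aemeasurable,
      Measure.map_apply (hU.prodMk hW) hH]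
    rfl
  have hslice (x : α) : (P.map W) (Prod.mk x ⁻¹' H) ≤ A.indicator 1 x + q := by
    by_cases hx : x ∈ A
    · rw [Set.indicator_of_mem hx]
      exact prob_le_one.trans le_self_add
    · rw [Set.indicator_of_notMem hx, zero_add, Measure.map_apply hW (measurable_prodMk_left hH),
        ← ofReal_measureReal, ← ENNReal.ofReal_coe_nnreal]
      exact ENNReal.ofReal_le_ofReal (h x hx)
  have hle : P {ω | (U ω, W ω) ∈ H} ≤ P {ω | U ω ∈ A} + q := by
    rw [hjoint]
    refine (lintegral_mono hslice).trans_eq ?_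
    rw [lintegral_add_right _ measurable_const, lintegral_indicator_one hA, lintegral_const,
      measure_univ, mul_one, Measure.map_apply hU hA]
    rfl
  simpa [measureReal_def, ENNReal.toReal_add] using ENNReal.toReal_mono (by simp) hle

variable [FiniteDimensional ℝ E] [MeasurableSpace E] [BorelSpace E]

lemma measureReal_abs_inner_starProjection_orthogonal_span_ge_le [IsProbabilityMeasure P]
    [Finite ι] {U : Ω → α} (hU : Measurable U) (he : Measurable e) (hUe : IndepFun U e P)
    (hsub : HasSubgaussianMarginals e c P) {a : ι → α → E} (ha : ∀ i, Measurable (a i))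
    {u : α → E} (hu : Measurable u) (R : ℝ) {t : ℝ} (ht : 0 ≤ t) :
    P.real {ω | t ≤ |inner ℝ (u (U ω))
        ((Submodule.span ℝ (Set.range (a · (U ω))))ᗮ.starProjection (e ω))|}
      ≤ P.real {ω | R ≤ ‖u (U ω)‖ ^ 2} + 2 * Real.exp (-t ^ 2 / (2 * (c * R))) := by
  let H : Set (α × E) := {z | t ≤ |inner ℝ (u z.1)
    ((Submodule.span ℝ (Set.range (a · z.1)))ᗮ.starProjection z.2)|}
  have hH : MeasurableSet H :=
    measurableSet_le measurable_const (measurable_inner_starProjection_orthogonal_span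
      (fun i => (ha i).comp measurable_fst) (hu.comp measurable_fst) measurable_snd).abs
  have hA : MeasurableSet {x | R ≤ ‖u x‖ ^ 2} :=
    measurableSet_le measurable_const (hu.norm.pow_const 2)
  refine measureReal_le_of_indepFun hU he hUe hH hA (by positivity) fun x hx => ?_
  exact hsub.measureReal_abs_inner_starProjection_ge_le (Submodule.span ℝ (Set.range (a · x)))ᗮ
    (not_le.1 hx).le ht

end ConditionalTail

section Stacking

variable {K nT nS p : ℕ} {S : Fin (K + 1) → Set (Fin p)}

/-- The index type of the observations of all the tasks. -/
abbrev Row (K nT nS : ℕ) : Type := (k : Fin (K + 1)) × Fin (sampleSize K nT nS k)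

/-- The index type of the scalar parameters, `(k, j)` being the `j`-th coordinate of block `k`. -/
abbrev Coord (K p : ℕ) : Type := Fin (K + 1) × Fin p

/-- The observations of all the tasks as one vector, with the Euclidean norm. -/
def stack (y : Sample K nT nS) : EuclideanSpace ℝ (Row K nT nS) := WithLp.toLp 2 fun r => y r.1 r.2

/-- The feature vectors of all the observations. -/
def designRows (X : Design K nT nS p) : Row K nT nS → Fin p → ℝ := fun r => X r.1 r.2

/-- The column of the stacked design which belongs to a scalar parameter: a coordinate of `β` acts
on the observations of all the tasks, a coordinate of `δ⁽ᵏ⁾` on those of task `k` only. -/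
noncomputable def stackedCol (x : Row K nT nS → Fin p → ℝ) (q : Coord K p) :
    EuclideanSpace ℝ (Row K nT nS) :=
  WithLp.toLp 2 fun r => if q.1 = 0 ∨ q.1 = r.1 then x r q.2 else 0

/-- The parameter blocks `(β, δ⁽¹⁾, …, δ⁽ᴷ⁾)` as one vector of scalar parameters. -/
def coordinates : Param K p ≃ (Coord K p → ℝ) where
  toFun θ q := block θ q.1 q.2
  invFun b := (fun j => b (0, j), fun k j => b (k.succ, j))
  left_inv _ := rfl
  right_inv b := funext fun ⟨k, j⟩ => by induction k using Fin.cases <;> rfl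

/-- The scalar parameters which the oracle leaves free. -/
def oracleIndices (S : Fin (K + 1) → Set (Fin p)) : Set (Coord K p) := {q | q.2 ∈ S q.1}

/-- The penalty level of each of the blocks `β, δ⁽¹⁾, …, δ⁽ᴷ⁾`. -/
def penaltyLevel (lam₀ lam₁ : ℝ) : Fin (K + 1) → ℝ := Fin.cons lam₀ fun _ => lam₁

lemma coordinates_apply (θ : Param K p) (q : Coord K p) :
    coordinates θ q = block θ q.1 q.2 :=
  rfl

lemma taskCoef_eq_sum (θ : Param K p) (k : Fin (K + 1)) (j : Fin p) :
    taskCoef θ k j = ∑ l, if l = 0 ∨ l = k then block θ l j else 0 := by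
  rw [Fin.sum_univ_succ]
  induction k using Fin.cases <;> simp [taskCoef, block, Fin.succ_ne_zero]

lemma sum_coordinates_smul_stackedCol_apply (X : Design K nT nS p) (θ : Param K p)
    (r : Row K nT nS) :
    (∑ q, coordinates θ q • stackedCol (designRows X) q) r = (X r.1 *ᵥ taskCoef θ r.1) r.2 := by
  simp only [coordinates_apply, stackedCol, designRows, Matrix.mulVec, dotProduct,
    taskCoef_eq_sum, Finset.mul_sum, WithLp.ofLp_sum, WithLp.ofLp_smul, Finset.sum_apply,
    Pi.smul_apply, smul_eq_mul, Fintype.sum_prod_type_right, mul_ite, mul_zero, mul_comm]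

lemma stack_response (X : Design K nT nS p) (ε : Sample K nT nS) (θ : Param K p) :
    stack (response X ε θ)
      = ∑ q, coordinates θ q • stackedCol (designRows X) q + stack ε := by
  ext r
  rw [PiLp.add_apply, sum_coordinates_smul_stackedCol_apply]
  rfl

lemma loss_eq_leastSquares (X : Design K nT nS p) (y : Sample K nT nS) (θ : Param K p) :
    loss X y θ = leastSquares (1 / totalSize K nT nS) (stackedCol (designRows X)) (stack y)
      (coordinates θ) := by
  simp only [loss, leastSquares, EuclideanSpace.real_norm_sq_eq, Fintype.sum_sigma, PiLp.sub_apply,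
    sum_coordinates_smul_stackedCol_apply, stack]

lemma objective_eq_lasso (X : Design K nT nS p) (y : Sample K nT nS) (lam₀ lam₁ : ℝ)
    (w : Fin (K + 1) → Fin p → ℝ) (θ : Param K p) :
    objective X y lam₀ lam₁ w θ
      = lasso (1 / totalSize K nT nS) (stackedCol (designRows X)) (stack y)
        (fun q => w q.1 q.2 * penaltyLevel lam₀ lam₁ q.1) (coordinates θ) := by
  rw [objective, lasso, loss_eq_leastSquares, add_assoc, Fintype.sum_prod_type, Fin.sum_univ_succ]
  simp only [penaltyLevel, coordinates_apply, block, Fin.cons_zero, Fin.cons_succ,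
    Finset.mul_sum, mul_left_comm, mul_assoc]

lemma mem_oracleFeasible_iff {θ : Param K p} :
    θ ∈ oracleFeasible S ↔ coordinates θ ∈ supportedOn (oracleIndices S) :=
  (Prod.forall (p := fun q : Coord K p => q ∉ oracleIndices S → block θ q.1 q.2 = 0)).symm

lemma mem_fusedSolutions_iff {X : Design K nT nS p} {y : Sample K nT nS} {lam₀ lam₁ : ℝ}
    {w : Fin (K + 1) → Fin p → ℝ} {θ : Param K p} :
    θ ∈ fusedSolutions X y lam₀ lam₁ w ↔
      IsMinOn (lasso (1 / totalSize K nT nS) (stackedCol (designRows X)) (stack y)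
        fun q => w q.1 q.2 * penaltyLevel lam₀ lam₁ q.1) Set.univ (coordinates θ) := by
  simp only [fusedSolutions, Set.mem_ofPred_eq, isMinOn_univ_iff, objective_eq_lasso,
    coordinates.surjective.forall]

lemma mem_oracleSolutions_iff {X : Design K nT nS p} {y : Sample K nT nS} {θ : Param K p} :
    θ ∈ oracleSolutions X y S ↔ coordinates θ ∈ supportedOn (oracleIndices S) ∧
      IsMinOn (leastSquares (1 / totalSize K nT nS) (stackedCol (designRows X)) (stack y))
        (supportedOn (oracleIndices S)) (coordinates θ) := by
  simp only [oracleSolutions, Set.mem_ofPred_eq, isMinOn_iff, mem_oracleFeasible_iff,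
    loss_eq_leastSquares, coordinates.surjective.forall]

lemma IsDualCertificate.fusedSolutions_eq_oracleSolutions {X : Design K nT nS p}
    {y : Sample K nT nS} {lam₀ lam₁ : ℝ} {r : EuclideanSpace ℝ (Row K nT nS)}
    (h : IsDualCertificate (1 / totalSize K nT nS) (stackedCol (designRows X)) (stack y)
      (oracleIndices S) (fun q => oracleWeight S q.1 q.2 * penaltyLevel lam₀ lam₁ q.1) r) :
    (fusedSolutions X y lam₀ lam₁ (oracleWeight S)).Nonempty ∧
      fusedSolutions X y lam₀ lam₁ (oracleWeight S) = oracleSolutions X y S := by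
  have hN : (0 : ℝ) ≤ 1 / totalSize K nT nS := by positivity
  obtain ⟨b, hb⟩ := h.exists_isMinOn_lasso hN
  refine ⟨⟨coordinates.symm b, ?_⟩, Set.ext fun θ => ?_⟩
  · rwa [mem_fusedSolutions_iff, Equiv.apply_symm_apply]
  · rw [mem_fusedSolutions_iff, mem_oracleSolutions_iff, h.isMinOn_lasso_iff hN]

/-- The residual of `e` after projecting out the columns of the stacked design which the oracle
may use. -/
noncomputable def oracleResidual (S : Fin (K + 1) → Set (Fin p)) (x : Row K nT nS → Fin p → ℝ)
    (e : EuclideanSpace ℝ (Row K nT nS)) : EuclideanSpace ℝ (Row K nT nS) :=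
  (Submodule.span ℝ (stackedCol x '' oracleIndices S))ᗮ.starProjection e

/-- Strict dual feasibility: off the oracle indices, the gradient of the loss at the oracle
estimator stays strictly below the penalty level. For features `x` and noise `e` the residual of
the oracle estimator is `oracleResidual S x e`, whatever the parameter. -/
def StrictDualFeasible (S : Fin (K + 1) → Set (Fin p)) (lam₀ lam₁ : ℝ)
    (x : Row K nT nS → Fin p → ℝ) (e : EuclideanSpace ℝ (Row K nT nS)) : Prop :=
  ∀ q ∉ oracleIndices S, 2 * (1 / totalSize K nT nS) * |inner ℝ (stackedCol x q)
    (oracleResidual S x e)| < penaltyLevel lam₀ lam₁ q.1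

lemma StrictDualFeasible.isDualCertificate {X : Design K nT nS p} {ε : Sample K nT nS}
    {θ : Param K p} {lam₀ lam₁ : ℝ}
    (h : StrictDualFeasible S lam₀ lam₁ (designRows X) (stack ε)) (hθ : θ ∈ oracleFeasible S) :
    IsDualCertificate (1 / totalSize K nT nS) (stackedCol (designRows X))
      (stack (response X ε θ)) (oracleIndices S)
      (fun q => oracleWeight S q.1 q.2 * penaltyLevel lam₀ lam₁ q.1)
      (oracleResidual S (designRows X) (stack ε)) where
  mem_orthogonal := Submodule.starProjection_apply_mem _ _
  sub_mem_span := by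
    rw [stack_response, oracleResidual, Submodule.starProjection_orthogonal_val, add_sub_assoc,
      sub_sub_cancel]
    exact Submodule.add_mem _ (sum_smul_mem_span_image (mem_oracleFeasible_iff.1 hθ))
      (Submodule.starProjection_apply_mem _ _)
  penalty_eq_zero q hq := by
    rw [oracleWeight, Set.indicator_of_notMem (show q.2 ∉ (S q.1)ᶜ from not_not.2 hq), zero_mul]
  abs_inner_lt q hq := by
    rw [oracleWeight, Set.indicator_of_mem (show q.2 ∈ (S q.1)ᶜ from hq), Pi.one_apply, one_mul]
    exact h q hq

/-- The number of observations on which the parameters of a block act. -/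
def blockSize (K nT nS : ℕ) : Fin (K + 1) → ℕ := Fin.cons (totalSize K nT nS) fun _ => nS

lemma le_totalSize (hK : 1 ≤ K) : nS ≤ totalSize K nT nS :=
  (Nat.le_mul_of_pos_left nS hK).trans (Nat.le_add_right _ _)

lemma le_blockSize (hK : 1 ≤ K) (k : Fin (K + 1)) : nS ≤ blockSize K nT nS k := by
  induction k using Fin.cases
  exacts [le_totalSize hK, le_rfl]

lemma card_filter_row (k : Fin (K + 1)) :
    (Finset.univ.filter fun r : Row K nT nS => k = 0 ∨ k = r.1).card = blockSize K nT nS k := by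
  have hsigma : (Finset.univ.filter fun r : Row K nT nS => k = 0 ∨ k = r.1)
      = (Finset.univ.filter fun l => k = 0 ∨ k = l).sigma fun _ => Finset.univ := by
    ext
    simp
  rw [hsigma, Finset.card_sigma]
  simp only [Finset.card_univ, Fintype.card_fin]
  induction k using Fin.cases with
  | zero => simp [blockSize, totalSize, Fin.sum_univ_succ, sampleSize, add_comm]
  | succ k => simp [blockSize, Fin.succ_ne_zero, sampleSize, Finset.filter_eq]

lemma norm_stackedCol_sq (x : Row K nT nS → Fin p → ℝ) (q : Coord K p) :
    ‖stackedCol x q‖ ^ 2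
      = ∑ r ∈ Finset.univ.filter (fun r : Row K nT nS => q.1 = 0 ∨ q.1 = r.1), x r q.2 ^ 2 := by
  simp [EuclideanSpace.real_norm_sq_eq, Finset.sum_filter, stackedCol, ite_pow]

lemma measurable_stackedCol (q : Coord K p) :
    Measurable fun x : Row K nT nS → Fin p → ℝ => stackedCol x q := by
  refine (WithLp.measurable_toLp 2 _).comp (measurable_pi_lambda _ fun r => ?_)
  split_ifs <;> fun_prop

lemma measurable_inner_stackedCol_oracleResidual (q : Coord K p) :
    Measurable fun z : (Row K nT nS → Fin p → ℝ) × EuclideanSpace ℝ (Row K nT nS) =>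
      inner ℝ (stackedCol z.1 q) (oracleResidual S z.1 z.2) := by
  classical
  simp only [oracleResidual, Set.image_eq_range]
  exact measurable_inner_starProjection_orthogonal_span
    (fun i => (measurable_stackedCol _).comp measurable_fst)
    ((measurable_stackedCol q).comp measurable_fst) measurable_snd

lemma measurableSet_strictDualFeasible {lam₀ lam₁ : ℝ} :
    MeasurableSet {z : (Row K nT nS → Fin p → ℝ) × EuclideanSpace ℝ (Row K nT nS) |
      StrictDualFeasible S lam₀ lam₁ z.1 z.2} := by
  simp only [StrictDualFeasible, Set.ofPred_forall]
  exact MeasurableSet.iInter fun q => MeasurableSet.iInter fun _ => measurableSet_lt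
    ((measurable_inner_stackedCol_oracleResidual q).abs.const_mul _) measurable_const

end Stacking

section Model

variable {Ω : Type*} [MeasurableSpace Ω] {K nT nS p : ℕ} {P : Measure Ω}
  {X : Ω → Design K nT nS p} {ε : Ω → Sample K nT nS} {S : Fin (K + 1) → Set (Fin p)} {τ v : ℝ≥0}

/-- The distributional setting of the dual certificate: features whose entries are independent along
each column and sub-Gaussian with constant `τ`, and an independent noise vector with sub-Gaussian
marginals of constant `v`. -/
structure SubGaussianModel (P : Measure Ω) (X : Ω → Design K nT nS p) (ε : Ω → Sample K nT nS)
    (τ v : ℝ≥0) : Prop where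
  measurable_design : Measurable fun ω => designRows (X ω)
  indep_column : ∀ j, iIndepFun (fun r ω => designRows (X ω) r j) P
  subGaussian_design : ∀ r j, HasSubgaussianMGF (fun ω => designRows (X ω) r j) τ P
  measurable_noise : Measurable fun ω => stack (ε ω)
  subGaussian_noise : HasSubgaussianMarginals (fun ω => stack (ε ω)) v P
  indep_noise : IndepFun (fun ω => designRows (X ω)) (fun ω => stack (ε ω)) P

lemma IsSubGaussianVector.hasSubgaussianMGF_apply {x : Ω → Fin p → ℝ}
    (hx : IsSubGaussianVector x τ P) (j : Fin p) : HasSubgaussianMGF (fun ω => x ω j) τ P := by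
  simpa [Pi.single_apply] using hx (EuclideanSpace.single j 1)

lemma NoiseAssumption.hasSubgaussianMarginals_stack {σ : Fin (K + 1) → ℝ≥0}
    (hε : NoiseAssumption P X ε σ v) : HasSubgaussianMarginals (fun ω => stack (ε ω)) v P :=
  hasSubgaussianMarginals_of_iIndepFun hε.indep fun r => hasSubgaussianMGF_mono
    (hasSubgaussianMGF_of_map_eq_gaussianReal (hε.measurable r.1 r.2).aemeasurable
      (hε.gaussian r.1 r.2)) (hε.variance_le r.1)

lemma DesignAssumption.subGaussianModel {Sig : Fin (K + 1) → Matrix (Fin p) (Fin p) ℝ}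
    {σ : Fin (K + 1) → ℝ≥0} {c : ℝ} (hX : DesignAssumption P X Sig τ c)
    (hε : NoiseAssumption P X ε σ v) : SubGaussianModel P X ε τ v where
  measurable_design := measurable_pi_lambda _ fun r => hX.measurable r.1 r.2
  indep_column j := hX.indep.comp (fun _ x => x j) fun _ => measurable_pi_apply j
  subGaussian_design r j := (hX.subGaussian r.1 r.2).hasSubgaussianMGF_apply j
  measurable_noise :=
    (WithLp.measurable_toLp 2 _).comp (measurable_pi_lambda _ fun r => hε.measurable r.1 r.2)
  subGaussian_noise := hε.hasSubgaussianMarginals_stack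
  indep_noise := hε.indep_design.comp measurable_id (WithLp.measurable_toLp 2 _)

namespace SubGaussianModel

lemma measureReal_norm_stackedCol_sq_ge_le [IsFiniteMeasure P] (h : SubGaussianModel P X ε τ v)
    (q : Coord K p) (A : ℝ) :
    P.real {ω | meanSquareLevel τ A * blockSize K nT nS q.1
        ≤ ‖stackedCol (designRows (X ω)) q‖ ^ 2}
      ≤ Real.exp (-A * blockSize K nT nS q.1) := by
  have hmeas (r : Row K nT nS) : Measurable fun ω => designRows (X ω) r q.2 :=
    measurable_pi_iff.1 (measurable_pi_iff.1 h.measurable_design r) q.2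
  simpa only [norm_stackedCol_sq, card_filter_row] using
    measureReal_sum_sq_ge_le hmeas (h.indep_column q.2) (fun r => h.subGaussian_design r q.2)
      (Finset.univ.filter fun r : Row K nT nS => q.1 = 0 ∨ q.1 = r.1) A

lemma measureReal_abs_inner_oracleResidual_ge_le [IsProbabilityMeasure P]
    (h : SubGaussianModel P X ε τ v) (S : Fin (K + 1) → Set (Fin p)) (q : Coord K p) (A : ℝ)
    {t : ℝ} (ht : 0 ≤ t) :
    P.real {ω | t ≤ |inner ℝ (stackedCol (designRows (X ω)) q)
        (oracleResidual S (designRows (X ω)) (stack (ε ω)))|}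
      ≤ Real.exp (-A * blockSize K nT nS q.1)
        + 2 * Real.exp (-t ^ 2 / (2 * (v * (meanSquareLevel τ A * blockSize K nT nS q.1)))) := by
  classical
  have htail := measureReal_abs_inner_starProjection_orthogonal_span_ge_le h.measurable_design
    h.measurable_noise h.indep_noise h.subGaussian_noise
    (fun i : oracleIndices S => measurable_stackedCol i.1) (measurable_stackedCol q)
    (meanSquareLevel τ A * blockSize K nT nS q.1) ht
  simp only [oracleResidual, Set.image_eq_range]
  exact htail.trans (add_le_add_left (h.measureReal_norm_stackedCol_sq_ge_le q A) _)

lemma measurableSet_strictDualFeasible_stack (h : SubGaussianModel P X ε τ v) (lam₀ lam₁ : ℝ) :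
    MeasurableSet {ω | StrictDualFeasible S lam₀ lam₁ (designRows (X ω)) (stack (ε ω))} :=
  measurableSet_preimage (h.measurable_design.prodMk h.measurable_noise)
    measurableSet_strictDualFeasible

lemma measureReal_not_lt_penaltyLevel_le [IsProbabilityMeasure P] (h : SubGaussianModel P X ε τ v)
    (hv : 0 < v) (hK : 1 ≤ K) (hnS : 0 < nS) {lam₀ lam₁ A L : ℝ} (hA : 0 ≤ A) (hL : L ≤ A * nS)
    (q : Coord K p) (hlam : 0 ≤ penaltyLevel lam₀ lam₁ q.1)
    (hlam_sq : 8 * v * meanSquareLevel τ A * L * blockSize K nT nS q.1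
      ≤ (totalSize K nT nS * penaltyLevel lam₀ lam₁ q.1) ^ 2) :
    P.real {ω | penaltyLevel lam₀ lam₁ q.1 ≤ 2 * (1 / totalSize K nT nS) *
        |inner ℝ (stackedCol (designRows (X ω)) q)
          (oracleResidual S (designRows (X ω)) (stack (ε ω)))|}
      ≤ 3 * Real.exp (-L) := by
  set N : ℝ := ((totalSize K nT nS : ℕ) : ℝ)
  set n : ℝ := ((blockSize K nT nS q.1 : ℕ) : ℝ)
  let t : ℝ := N * penaltyLevel lam₀ lam₁ q.1 / 2
  have hn : (nS : ℝ) ≤ n := Nat.cast_le.2 (le_blockSize hK q.1)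
  have hnS' : (0 : ℝ) < nS := by exact_mod_cast hnS
  have hN : 0 < N := Nat.cast_pos.2 (hnS.trans_le (le_totalSize hK))
  have hM : 0 < meanSquareLevel τ A := by unfold meanSquareLevel; positivity
  have hset (z : ℝ) : penaltyLevel lam₀ lam₁ q.1 ≤ 2 * (1 / N) * z ↔ t ≤ z := by
    rw [div_le_iff₀ two_pos, mul_one_div, div_mul_eq_mul_div, le_div_iff₀' hN, mul_comm z]
  have hdesign : Real.exp (-A * n) ≤ Real.exp (-L) :=
    Real.exp_le_exp.2 (by nlinarith [mul_le_mul_of_nonneg_left hn hA])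
  have hnoise : Real.exp (-t ^ 2 / (2 * (v * (meanSquareLevel τ A * n)))) ≤ Real.exp (-L) := by
    have hden : 0 < 2 * (v * (meanSquareLevel τ A * n)) := by
      have : 0 < n := hnS'.trans_le hn
      positivity
    rw [Real.exp_le_exp, div_le_iff₀ hden]
    simp only [t]
    linarith
  simp only [hset]
  refine (h.measureReal_abs_inner_oracleResidual_ge_le S q A (by positivity)).trans ?_
  linarith

theorem measureReal_not_strictDualFeasible_le [IsProbabilityMeasure P]
    (h : SubGaussianModel P X ε τ v) (hv : 0 < v) (hK : 1 ≤ K) (hnS : 0 < nS) {lam₀ lam₁ A L : ℝ}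
    (hA : 0 ≤ A) (hL : L ≤ A * nS) (hlam : ∀ k : Fin (K + 1), 0 ≤ penaltyLevel lam₀ lam₁ k)
    (hlam_sq : ∀ k, 8 * v * meanSquareLevel τ A * L * blockSize K nT nS k
      ≤ (totalSize K nT nS * penaltyLevel lam₀ lam₁ k) ^ 2) :
    P.real {ω | StrictDualFeasible S lam₀ lam₁ (designRows (X ω)) (stack (ε ω))}ᶜ
      ≤ (K + 1) * p * (3 * Real.exp (-L)) := by
  let bad (q : Coord K p) : Set Ω :=
    {ω | penaltyLevel lam₀ lam₁ q.1 ≤ 2 * (1 / totalSize K nT nS) *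
      |inner ℝ (stackedCol (designRows (X ω)) q)
        (oracleResidual S (designRows (X ω)) (stack (ε ω)))|}
  have hsub : {ω | StrictDualFeasible S lam₀ lam₁ (designRows (X ω)) (stack (ε ω))}ᶜ
      ⊆ ⋃ q, bad q := by
    intro ω hω
    simp only [Set.mem_compl_iff, Set.mem_ofPred_eq, StrictDualFeasible, not_forall, not_lt] at hω
    obtain ⟨q, -, hq⟩ := hω
    exact Set.mem_iUnion.2 ⟨q, hq⟩
  calc P.real {ω | StrictDualFeasible S lam₀ lam₁ (designRows (X ω)) (stack (ε ω))}ᶜ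
      ≤ ∑ q, P.real (bad q) := (measureReal_mono hsub).trans (measureReal_iUnion_fintype_le _)
    _ ≤ ∑ _q : Coord K p, 3 * Real.exp (-L) := Finset.sum_le_sum fun q _ =>
        h.measureReal_not_lt_penaltyLevel_le hv hK hnS hA hL q (hlam q.1) (hlam_sq q.1)
    _ = (K + 1) * p * (3 * Real.exp (-L)) := by simp

end SubGaussianModel

end Model

section Rates

lemma le_penaltyLevel {K nT nS : ℕ} {lam₀ lam₁ C l : ℝ} (hN : totalSize K nT nS ≠ 0)
    (hlam₀ : C * √(l / totalSize K nT nS) ≤ lam₀)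
    (hlam₁ : C * ((nS : ℝ) / totalSize K nT nS * √(l / nS)) ≤ lam₁) (k : Fin (K + 1)) :
    C * (blockSize K nT nS k / totalSize K nT nS * √(l / blockSize K nT nS k))
      ≤ penaltyLevel lam₀ lam₁ k := by
  induction k using Fin.cases with
  | zero => simpa [blockSize, penaltyLevel, hN] using hlam₀
  | succ => exact hlam₁

lemma sq_mul_le_sq_mul_of_rate_le {C n N l μ : ℝ} (hC : 0 ≤ C) (hn : 0 < n) (hN : 0 < N)
    (hl : 0 ≤ l) (h : C * (n / N * √(l / n)) ≤ μ) : C ^ 2 * (n * l) ≤ (N * μ) ^ 2 :=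
  calc C ^ 2 * (n * l) = (N * (C * (n / N * √(l / n)))) ^ 2 := by
        simp only [mul_pow, div_pow, Real.sq_sqrt (div_nonneg hl hn.le)]
        field_simp
    _ ≤ (N * μ) ^ 2 := by gcongr

lemma union_bound_le {K p : ℕ} {a c₁ : ℝ} (hK : 1 ≤ K) (hp : 2 ≤ p)
    (hKp : Real.log K ≤ a * Real.log p) :
    (K + 1) * p * (3 * Real.exp (-((a + c₁ + 4) * Real.log p))) ≤ Real.exp (-c₁ * Real.log p) := by
  have hp₀ : (0 : ℝ) < p := by positivity
  have hK_le : (K : ℝ) ≤ Real.exp (a * Real.log p) := by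
    rwa [← Real.log_le_iff_le_exp (by positivity)]
  have hK_one : (1 : ℝ) ≤ K := by exact_mod_cast hK
  have hp_cube : (2 : ℝ) ^ 3 ≤ p ^ 3 := by gcongr; exact_mod_cast hp
  have hp_exp : Real.exp (4 * Real.log p) = p ^ 4 := by
    rw [← Nat.cast_ofNat, Real.exp_nat_mul, Real.exp_log hp₀]
  have hcard : ((K : ℝ) + 1) * 3 ≤ Real.exp (a * Real.log p) * p ^ 3 :=
    calc ((K : ℝ) + 1) * 3 ≤ K * 2 ^ 3 := by linarith
      _ ≤ Real.exp (a * Real.log p) * p ^ 3 := by gcongr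
  calc ((K : ℝ) + 1) * p * (3 * Real.exp (-((a + c₁ + 4) * Real.log p)))
      = (K + 1) * 3 * p * Real.exp (-((a + c₁ + 4) * Real.log p)) := by ring
    _ ≤ Real.exp (a * Real.log p) * p ^ 3 * p * Real.exp (-((a + c₁ + 4) * Real.log p)) := by
        gcongr
    _ = Real.exp (a * Real.log p) * Real.exp (4 * Real.log p)
          * Real.exp (-((a + c₁ + 4) * Real.log p)) := by rw [hp_exp]; ring
    _ = Real.exp (-c₁ * Real.log p) := by
        rw [← Real.exp_add, ← Real.exp_add]
        ring_nf

end Rates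

lemma mem_oracleFeasible_supp {K p : ℕ} (θ : Param K p) : θ ∈ oracleFeasible (supp θ) :=
  fun _ _ hj => not_not.1 hj

lemma SubGaussianModel.one_sub_exp_le_measureReal_strictDualFeasible {Ω : Type*}
    [MeasurableSpace Ω] {K nT nS p : ℕ} {P : Measure Ω} [IsProbabilityMeasure P]
    {X : Ω → Design K nT nS p} {ε : Ω → Sample K nT nS} {S : Fin (K + 1) → Set (Fin p)} {τ v : ℝ≥0}
    {cS a c₁ lam₀ lam₁ C : ℝ} (h : SubGaussianModel P X ε τ v) (hv : 0 < v) (hcS : 0 < cS)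
    (hκ : 0 ≤ a + c₁ + 4) (hC : 0 ≤ C)
    (hC_sq : 8 * v * meanSquareLevel τ ((a + c₁ + 4) / cS) * (a + c₁ + 4) ≤ C ^ 2)
    (hK : 1 ≤ K) (hp : 2 ≤ p) (hKp : Real.log K ≤ a * Real.log p) (hnS : cS * Real.log p ≤ nS)
    (hlam₀ : C * √(Real.log p / totalSize K nT nS) ≤ lam₀)
    (hlam₁ : C * ((nS : ℝ) / totalSize K nT nS * √(Real.log p / nS)) ≤ lam₁) :
    1 - Real.exp (-c₁ * Real.log p)
      ≤ P.real {ω | StrictDualFeasible S lam₀ lam₁ (designRows (X ω)) (stack (ε ω))} := by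
  have hlog : 0 < Real.log p := Real.log_pos (by exact_mod_cast hp)
  have hnS_pos : 0 < nS := by exact_mod_cast (mul_pos hcS hlog).trans_le hnS
  have hN : 0 < totalSize K nT nS := hnS_pos.trans_le (le_totalSize hK)
  have hrate := le_penaltyLevel hN.ne' hlam₀ hlam₁
  have hL : (a + c₁ + 4) * Real.log p ≤ (a + c₁ + 4) / cS * nS := by
    rw [div_mul_eq_mul_div, le_div_iff₀ hcS, mul_assoc, mul_comm _ cS]
    gcongr
  have hlam_sq (k : Fin (K + 1)) :
      8 * v * meanSquareLevel τ ((a + c₁ + 4) / cS) * ((a + c₁ + 4) * Real.log p)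
          * blockSize K nT nS k
        ≤ (totalSize K nT nS * penaltyLevel lam₀ lam₁ k) ^ 2 := by
    have hn : 0 < blockSize K nT nS k := hnS_pos.trans_le (le_blockSize hK k)
    calc _ = 8 * v * meanSquareLevel τ ((a + c₁ + 4) / cS) * (a + c₁ + 4)
          * (blockSize K nT nS k * Real.log p) := by ring
      _ ≤ C ^ 2 * (blockSize K nT nS k * Real.log p) := by gcongr
      _ ≤ _ := sq_mul_le_sq_mul_of_rate_le hC (by exact_mod_cast hn) (by exact_mod_cast hN) hlog.le
          (hrate k)
  rw [← sub_sub_cancel 1 (P.real _),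
    ← probReal_compl_eq_one_sub (h.measurableSet_strictDualFeasible_stack lam₀ lam₁)]
  gcongr
  exact (h.measureReal_not_strictDualFeasible_le hv hK hnS_pos (by positivity) hL
    (fun k => le_trans (by positivity) (hrate k)) hlam_sq).trans (union_bound_le hK hp hKp)

end AdaTrans

theorem theorem1_general (τ v : ℝ≥0) (hv : 0 < v) (cS : ℝ) (hcS : 0 < cS) (a : ℝ) (ha : 0 ≤ a)
    (c₁ : ℝ) (hc₁ : 0 < c₁) :
    ∃ C : ℝ, 0 < C ∧
      ∀ (K nT nS p : ℕ), 1 ≤ K → Real.log K ≤ a * Real.log p → cS * Real.log p ≤ nS →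
      ∀ (Ω : Type*) [MeasurableSpace Ω] (P : Measure Ω) [IsProbabilityMeasure P]
        (X : Ω → AdaTrans.Design K nT nS p) (ε : Ω → AdaTrans.Sample K nT nS)
        (S : Fin (K + 1) → Set (Fin p)) (θ : AdaTrans.Param K p),
      AdaTrans.SubGaussianModel P X ε τ v → θ ∈ AdaTrans.oracleFeasible S →
      ∀ lam₀ lam₁ : ℝ,
        C * √(Real.log p / AdaTrans.totalSize K nT nS) ≤ lam₀ →
        C * ((nS : ℝ) / AdaTrans.totalSize K nT nS * √(Real.log p / nS)) ≤ lam₁ →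
        ∃ E : Set Ω, MeasurableSet E ∧ 1 - Real.exp (-c₁ * Real.log p) ≤ P.real E ∧
          ∀ ω ∈ E,
            (AdaTrans.fusedSolutions (X ω) (AdaTrans.response (X ω) (ε ω) θ) lam₀ lam₁
              (AdaTrans.oracleWeight S)).Nonempty ∧
            AdaTrans.fusedSolutions (X ω) (AdaTrans.response (X ω) (ε ω) θ) lam₀ lam₁
                (AdaTrans.oracleWeight S) =
              AdaTrans.oracleSolutions (X ω) (AdaTrans.response (X ω) (ε ω) θ) S := by
  have hM : 0 < AdaTrans.meanSquareLevel τ ((a + c₁ + 4) / cS) := by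
    unfold AdaTrans.meanSquareLevel
    positivity
  have hC : 0 < √(8 * v * AdaTrans.meanSquareLevel τ ((a + c₁ + 4) / cS) * (a + c₁ + 4)) := by
    positivity
  refine ⟨_, hC, fun K nT nS p hK hKp hnS Ω _ P _ X ε S θ h hθ lam₀ lam₁ hlam₀ hlam₁ => ?_⟩
  obtain hp | hp := lt_or_ge p 2
  · have hlog : Real.log p = 0 := by interval_cases p <;> simp
    exact ⟨∅, .empty, by simp [hlog], by simp⟩
  exact ⟨_, h.measurableSet_strictDualFeasible_stack (S := S) lam₀ lam₁,
    h.one_sub_exp_le_measureReal_strictDualFeasible hv hcS (by positivity) hC.le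
      (Real.sq_sqrt (by positivity)).ge hK hp hKp hnS hlam₀ hlam₁,
    fun ω hω => (hω.isDualCertificate hθ).fusedSolutions_eq_oracleSolutions⟩

theorem theorem1 (c : ℝ) (hc : 0 < c) (τ : ℝ≥0) (cS : ℝ) (hcS : 0 < cS) (a : ℝ) (ha : 0 ≤ a) :
    ∃ C : ℝ, 0 < C ∧ ∃ c₁ : ℝ, 0 < c₁ ∧
      ∀ (K nT nS p : ℕ), 1 ≤ K → Real.log K ≤ a * Real.log p → cS * Real.log p ≤ nS →
      ∀ (Ω : Type*) [MeasurableSpace Ω] (P : Measure Ω) [IsProbabilityMeasure P]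
        (X : Ω → AdaTrans.Design K nT nS p) (ε : Ω → AdaTrans.Sample K nT nS)
        (Sig : Fin (K + 1) → Matrix (Fin p) (Fin p) ℝ) (σ : Fin (K + 1) → ℝ≥0)
        (θ : AdaTrans.Param K p),
      AdaTrans.DesignAssumption P X Sig τ c → AdaTrans.NoiseAssumption P X ε σ c →
      ∀ lam₀ lam₁ : ℝ,
        C * √(Real.log p / AdaTrans.totalSize K nT nS) ≤ lam₀ →
        C * ((nS : ℝ) / AdaTrans.totalSize K nT nS * √(Real.log p / nS)) ≤ lam₁ →
        ∃ E : Set Ω, MeasurableSet E ∧ 1 - Real.exp (-c₁ * Real.log p) ≤ P.real E ∧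
          ∀ ω ∈ E,
            (AdaTrans.fusedSolutions (X ω) (AdaTrans.response (X ω) (ε ω) θ) lam₀ lam₁
              (AdaTrans.oracleWeight (AdaTrans.supp θ))).Nonempty ∧
            AdaTrans.fusedSolutions (X ω) (AdaTrans.response (X ω) (ε ω) θ) lam₀ lam₁
                (AdaTrans.oracleWeight (AdaTrans.supp θ)) =
              AdaTrans.oracleSolutions (X ω) (AdaTrans.response (X ω) (ε ω) θ)
                (AdaTrans.supp θ) := by
  lift c to ℝ≥0 using hc.le
  obtain ⟨C, hC, h⟩ := theorem1_general τ c hc cS hcS a ha 1 one_pos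
  exact ⟨C, hC, 1, one_pos, fun K nT nS p hK hKp hnS Ω _ P _ X ε _ _ θ hX hε =>
    h K nT nS p hK hKp hnS Ω P X ε (AdaTrans.supp θ) θ (hX.subGaussianModel hε)
      (AdaTrans.mem_oracleFeasible_supp θ)⟩
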